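/- Let $\mathbb F_q$ be a finite field with $q$ elements. For integers $a\ge 1$, $b\ge 0$, $c\ge a-1$ and a rational function $f\in\mathbb F_q(x_1,\dots,x_c)$, let $\delta_{a;b}(f)\in\mathbb F_q(x_1,\dots,x_{c+1})$ be the quotient $\det(N)/\det(L)$ of $a\times a$ determinants, where $L=(x_j^{q^{i-1}})_{1\le i,j\le a}$, and $N$ is obtained from $L$ by replacing its last row by the row with entries $x_j^{q^b}f(x_1,\dots,\widehat{x_j},\dots,x_{c+1})$, $1\le j\le a$ (the hat means that the variable is omitted). Put $D_a=\delta_{a;a}(1)\in\mathbb F_q(x_1,\dots,x_a)$. For $m\ge 0$, $k\ge 1$ and sequences $I=(i_1,\dots,i_k)$, $J=(j_1,\dots,j_k)$ of non-negative integers, define $$Y_m(I;J)=\delta_{1;m}^{i_1}\Bigl(D_1^{j_1}\,\delta_{2;m}^{i_2}\bigl(D_2^{j_2}\cdots\delta_{k;m}^{i_k}(D_k^{j_k})\cdots\bigr)\Bigr).$$ Assume that $s-1\le m$ for every $s$ with $i_s>0$ (this holds in particular when $k\le m+1$). Then $Y_m(I;J)$ is a polynomial in the $n=k+i_1+\cdots+i_k$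 variables $x_1,\dots,x_n$ over $\mathbb F_q$, and the smallest monomial that occurs in it with non-zero coefficient, in the graded lexicographic order with $x_1>x_2>\cdots>x_n$, is $$\prod_{s=1}^{k}\Bigl(x_{i_1+\cdots+i_{s-1}+s}^{\,q^m-q^{s-1}}\cdots x_{i_1+\cdots+i_s+s-1}^{\,q^m-q^{s-1}}\Bigr)\,x_{i_1+\cdots+i_s+s}^{\,j_s q^{s-1}(q-1)},$$ where the product in parentheses runs over $i_s$ consecutive variables and is $1$ if $i_s=0$. -/

import Mathlib

open scoped MonomialOrder

noncomputable section

namespace BorelInv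

/-- Rational functions over `F` in the variables `x₁, x₂, x₃, …`; the variable `x_{i+1}` is
`X i`.  The field `F(x₁, …, x_c)` of rational functions in `c` variables is the subfield of
those that involve only `X 0, …, X (c - 1)`, and every rational function lies in one of these. -/
abbrev RatFun (F : Type*) [Field F] : Type _ := FractionRing (MvPolynomial ℕ F)

/-- The variable `x_{i+1}` as a rational function. -/
def var (F : Type*) [Field F] (i : ℕ) : RatFun F :=
  algebraMap (MvPolynomial ℕ F) (RatFun F) (MvPolynomial.X i)

/-- The increasing enumeration of `ℕ \ {j}`. -/
def skip (j i : ℕ) : ℕ := if i < j then i else i + 1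

theorem skip_injective (j : ℕ) : Function.Injective (skip j) := by
  intro a b h
  unfold skip at h
  split_ifs at h <;> omega

/-- `omitVar j f` is `f(x₁, …, x̂_{j+1}, …, x_{c+1})`: the variables of the list
`x₁, x₂, …` with `x_{j+1}` left out are substituted, in order, for the variables of `f`. -/
def omitVar {F : Type*} [Field F] (j : ℕ) : RatFun F →+* RatFun F :=
  IsFractionRing.map (A := MvPolynomial ℕ F) (B := MvPolynomial ℕ F)
    (j := (MvPolynomial.rename (skip j) : MvPolynomial ℕ F →ₐ[F] MvPolynomial ℕ F).toRingHom)
    (MvPolynomial.rename_injective (skip j) (skip_injective j))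

/-- The `a × a` matrix whose first `a - 1` rows are `(x_1^{q^i}, …, x_a^{q^i})`,
`i = 0, …, a - 2`, and whose last row has the entries
`x_j^{q^b} f(x₁, …, x̂_j, …, x_{c+1})`, `j = 1, …, a`.  Here `q = |F|`. -/
def deltaNum {F : Type*} [Field F] [Fintype F] (a b : ℕ) (f : RatFun F) :
    Matrix (Fin a) (Fin a) (RatFun F) :=
  Matrix.of fun i j =>
    if (i : ℕ) + 1 = a then var F j ^ (Fintype.card F ^ b) * omitVar (j : ℕ) f
    else var F j ^ (Fintype.card F ^ (i : ℕ))

/-- The `a × a` matrix with rows `(x_1^{q^i}, …, x_a^{q^i})`, `i = 0, …, a - 1`. -/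
def deltaDen (F : Type*) [Field F] [Fintype F] (a : ℕ) :
    Matrix (Fin a) (Fin a) (RatFun F) :=
  Matrix.of fun i j => var F j ^ (Fintype.card F ^ (i : ℕ))

/-- The operator `δ_{a;b}` (for `a ≥ 1`), a quotient of two determinants.  The formula does
not depend on the number `c ≥ a - 1` of variables in which `f` is considered. -/
def delta {F : Type*} [Field F] [Fintype F] (a b : ℕ) (f : RatFun F) : RatFun F :=
  (deltaNum a b f).det / (deltaDen F a).det

/-- `D_a = δ_{a;a}(1)`. -/
def dickson (F : Type*) [Field F] [Fintype F] (a : ℕ) : RatFun F := delta a a 1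

/-- `δ_{s;b}^{i₁}(D_s^{j₁} δ_{s+1;b}^{i₂}(D_{s+1}^{j₂} ⋯ δ_{s+k-1;b}^{i_k}(D_{s+k-1}^{j_k}) ⋯ ))`. -/
def YFrom (F : Type*) [Field F] [Fintype F] (b : ℕ) :
    (s k : ℕ) → (Fin k → ℕ) → (Fin k → ℕ) → RatFun F
  | _, 0, _, _ => 1
  | s, k + 1, I, J =>
      (delta s b)^[I 0] (dickson F s ^ J 0 * YFrom F b (s + 1) k (Fin.tail I) (Fin.tail J))

/-- `Y_b(I; J) = δ_{1;b}^{i₁}(D_1^{j₁} δ_{2;b}^{i₂}(D_2^{j₂} ( ⋯ δ_{k;b}^{i_k}(D_k^{j_k}) ⋯ )))`,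
where `i_{s+1} = I s` and `j_{s+1} = J s`. -/
def Y (F : Type*) [Field F] [Fintype F] (b : ℕ) {k : ℕ} (I J : Fin k → ℕ) : RatFun F :=
  YFrom F b 1 k I J

/-- A polynomial in `n` variables, regarded as a rational function. -/
def polyToRat {F : Type*} [Field F] (n : ℕ) (P : MvPolynomial (Fin n) F) : RatFun F :=
  algebraMap (MvPolynomial ℕ F) (RatFun F) (MvPolynomial.rename (fun i : Fin n => (i : ℕ)) P)

theorem block_lt {k : ℕ} (I : Fin k → ℕ) (s : Fin k) (t : Fin (I s + 1)) :
    (∑ r ∈ Finset.Iio s, I r) + (s : ℕ) + (t : ℕ) < k + ∑ r, I r := by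
  have h1 : (∑ r ∈ Finset.Iio s, I r) + I s ≤ ∑ r, I r := by
    rw [add_comm, ← Finset.sum_insert (s := Finset.Iio s) (a := s) (f := I) (by simp)]
    exact Finset.sum_le_sum_of_subset (Finset.subset_univ _)
  have h2 := s.isLt
  have h3 := t.isLt
  omega

/-- The variables are divided into `k` consecutive blocks, the `s`-th of length `i_s + 1`.
`blockVar I s t` is the (zero-based) `t`-th variable of the block with zero-based number `s`,
that is, the variable `x_{i_1 + ⋯ + i_{s'-1} + s' + t}` with `s' = s + 1`. -/
def blockVar {k : ℕ} (I : Fin k → ℕ) (s : Fin k) (t : Fin (I s + 1)) : Fin (k + ∑ r, I r) :=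
  ⟨(∑ r ∈ Finset.Iio s, I r) + (s : ℕ) + (t : ℕ), block_lt I s t⟩

/-- The exponent vector of
`∏_{s=1}^k x_{i_1+⋯+i_{s-1}+s}^{q^m-q^{s-1}} ⋯ x_{i_1+⋯+i_s+s-1}^{q^m-q^{s-1}}
  x_{i_1+⋯+i_s+s}^{j_s q^{s-1}(q-1)}`. -/
def lowExponent (q m : ℕ) {k : ℕ} (I J : Fin k → ℕ) : Fin (k + ∑ r, I r) →₀ ℕ :=
  ∑ s : Fin k,
    ((∑ t : Fin (I s), Finsupp.single (blockVar I s t.castSucc) (q ^ m - q ^ (s : ℕ)))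
      + Finsupp.single (blockVar I s (Fin.last (I s))) (J s * q ^ (s : ℕ) * (q - 1)))

end BorelInv

end

/-! Polynomiality. Call f good for (m, r) if it is symmetric in x_1, …, x_r and satisfies the
exchange relation of `Good`. Then the numerator of δ_{r+1;m}(f) is the exterior product of x^{q^m}
with the alternating function (Moore determinant in r variables)·f, and the exchange relation makes
it vanish whenever one of the first r+1 variables is an F_q-combination of the earlier ones. The
Moore determinant of size r+1 is, up to a unit, the product of the linear forms defining these
hyperplanes, so it divides the numerator (`moore_dvd`, `Good.moore_dvd_numer`), and the quotient is
again good (`Good.quotient`). Multiplication by D_{r+1}, which is invariant under invertible linear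
substitutions, preserves goodness for r+1, and goodness for r+1 implies goodness for r. Hence every
stage of Y is a polynomial, built from the inside out. It is also homogeneous, so graded lex
comparison reduces to lex.

Lowest monomial. Setting x_1 = 0 and renumbering turns δ_{a+1;m+1} and D_{a+1} into q-th powers of
δ_{a;m} and D_a (`dropVar_quotient`). So the factor of Y starting at s = 2 restricts to the q-th
power of Y_{m-1} of the tails of I and J (`dropVar_YPoly`). Monomials free of x_1 are
lexicographically below all others, so the lowest monomial is visible in a nonzero restriction. The
outermost level is explicit: D_1 = x_1^{q-1} and δ_{1;m}(f) = x_1^{q^m-1} f(x_2, …). This gives the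
recursion `lowExp`, which is then solved in closed form. -/

open MvPolynomial Function

noncomputable section

namespace BorelInv

/-! ### Moore determinants and their behaviour under linear substitutions -/

section

variable {F : Type*} [Field F]

theorem aeval_aeval_apply (w v : ℕ → MvPolynomial ℕ F) (f : MvPolynomial ℕ F) :
    aeval w (aeval v f) = aeval (fun i => aeval w (v i)) f := by
  rw [← AlgHom.comp_apply, comp_aeval]

theorem aeval_update (w v : ℕ → MvPolynomial ℕ F) (i : ℕ) (y : MvPolynomial ℕ F) :
    (fun k => aeval w (update v i y k)) = update (fun k => aeval w (v k)) i (aeval w y) := by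
  ext1 k
  by_cases h : k = i
  · subst h; simp
  · simp [h]

/-- The linear combination `∑_{i < r} c_i v_i`. -/
def lin (r : ℕ) (c : ℕ → F) (v : ℕ → MvPolynomial ℕ F) : MvPolynomial ℕ F :=
  ∑ i ∈ Finset.range r, c i • v i

theorem aeval_lin (w v : ℕ → MvPolynomial ℕ F) (r : ℕ) (c : ℕ → F) :
    aeval w (lin r c v) = lin r c (fun i => aeval w (v i)) := by
  simp [lin, map_sum]

theorem lin_congr {r : ℕ} {c : ℕ → F} {v w : ℕ → MvPolynomial ℕ F} (h : ∀ i < r, v i = w i) :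
    lin r c v = lin r c w :=
  Finset.sum_congr rfl fun i hi => by rw [h i (Finset.mem_range.mp hi)]

theorem update_comp_skip (r : ℕ) (v : ℕ → MvPolynomial ℕ F) {i : ℕ} (hi : i < r)
    (y : MvPolynomial ℕ F) : update v i y ∘ skip r = update (v ∘ skip r) i y := by
  ext1 k
  simp only [comp_apply, update_apply, skip]
  split_ifs <;> first | rfl | omega

theorem lin_comp_skip (r : ℕ) (c : ℕ → F) (v : ℕ → MvPolynomial ℕ F) :
    lin r c (v ∘ skip r) = lin r c v :=
  lin_congr fun i hi => by simp [skip, hi]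

variable [Fintype F]

local notation "q" => Fintype.card F

theorem smul_add_pow_card (n : ℕ) (c : F) (x y : MvPolynomial ℕ F) :
    (c • x + y) ^ q ^ n = c • x ^ q ^ n + y ^ q ^ n := by
  induction n with
  | zero => simp
  | succ n ih =>
    rw [pow_succ, pow_mul, ih]
    simpa [pow_mul] using map_add (FiniteField.frobeniusAlgHom F (MvPolynomial ℕ F)) (c • x ^ q ^ n) (y ^ q ^ n)

theorem sum_smul_pow_card {ι : Type*} (n : ℕ) (s : Finset ι) (c : ι → F)
    (x : ι → MvPolynomial ℕ F) :
    (∑ i ∈ s, c i • x i) ^ q ^ n = ∑ i ∈ s, c i • x i ^ q ^ n := by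
  classical
  induction s using Finset.induction_on with
  | empty => simp [Fintype.card_ne_zero]
  | insert a s ha ih => rw [Finset.sum_insert ha, Finset.sum_insert ha, smul_add_pow_card, ih]

theorem lin_pow_card (n r : ℕ) (c : ℕ → F) (v : ℕ → MvPolynomial ℕ F) :
    lin r c v ^ q ^ n = lin r c (fun i => v i ^ q ^ n) :=
  sum_smul_pow_card _ _ _ _

/-- The determinant of the `r × r` matrix with entries `v_j ^ q ^ e_i`. -/
def powDet (r : ℕ) (e : ℕ → ℕ) (v : ℕ → MvPolynomial ℕ F) : MvPolynomial ℕ F :=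
  (Matrix.of fun i j : Fin r => v j ^ q ^ e i).det

theorem aeval_powDet (w v : ℕ → MvPolynomial ℕ F) (r : ℕ) (e : ℕ → ℕ) :
    aeval w (powDet r e v) = powDet r e (fun i => aeval w (v i)) := by
  unfold powDet
  rw [AlgHom.map_det]
  congr 1
  ext1 i j
  simp

theorem powDet_congr {r : ℕ} {e : ℕ → ℕ} {v w : ℕ → MvPolynomial ℕ F} (h : ∀ i < r, v i = w i) :
    powDet r e v = powDet r e w := by
  unfold powDet
  congr 1
  ext1 i j
  simp [h j j.isLt]

/-- Since x ↦ x^{q^e} is F_q-linear, column i becomes the same combination of the columns, of which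
only the multiple of column i itself survives. -/
theorem powDet_update_lin (r : ℕ) (e : ℕ → ℕ) (c : ℕ → F) (v : ℕ → MvPolynomial ℕ F) {i : ℕ}
    (hi : i < r) : powDet r e (update v i (lin r c v)) = c i • powDet r e v := by
  unfold powDet
  have := Matrix.det_updateCol_sum (Matrix.of fun i j : Fin r => v j ^ q ^ e i) ⟨i, hi⟩
    (fun j => C (c j))
  rw [smul_eq_mul, ← smul_eq_C_mul] at this
  rw [← this]
  congr 1
  ext1 k j
  by_cases h : j = ⟨i, hi⟩
  · subst h
    simp only [Matrix.of_apply, Matrix.updateCol_self, update_self, lin_pow_card]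
    simp [lin, Finset.sum_range, smul_eq_C_mul]
  · have : (j : ℕ) ≠ i := fun h' => h (Fin.ext h')
    simp [h, this]

theorem powDet_swap (r : ℕ) (e : ℕ → ℕ) (v : ℕ → MvPolynomial ℕ F) {i j : ℕ}
    (hi : i < r) (hj : j < r) (hij : i ≠ j) :
    powDet r e (v ∘ Equiv.swap i j) = - powDet r e v := by
  unfold powDet
  have := Matrix.det_permute' (Equiv.swap (⟨i, hi⟩ : Fin r) ⟨j, hj⟩)
    (Matrix.of fun i j : Fin r => v j ^ q ^ e i)
  rw [Equiv.Perm.sign_swap (by simpa using hij)] at this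
  simp only [Units.val_neg, Units.val_one, Int.cast_neg, Int.cast_one, neg_mul, one_mul] at this
  rw [← this]
  congr 1
  ext1 k l
  simp only [Matrix.of_apply, Matrix.submatrix_apply, comp_apply, id]
  congr 2
  simp only [Equiv.swap_apply_def, Fin.ext_iff]
  split_ifs <;> rfl

/-- The Moore determinant `det (v_j ^ q ^ i)_{i, j < r}`. -/
def moore (r : ℕ) (v : ℕ → MvPolynomial ℕ F) : MvPolynomial ℕ F := powDet r id v

/-- The determinant of the Moore matrix of size `a` with its last row replaced by `ρ`. -/
def lastRowDet (a : ℕ) (ρ v : ℕ → MvPolynomial ℕ F) : MvPolynomial ℕ F :=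
  (Matrix.of fun i j : Fin a => if (i : ℕ) + 1 = a then ρ j else v j ^ q ^ (i : ℕ)).det

theorem lastRowDet_single_last (r : ℕ) (v : ℕ → MvPolynomial ℕ F) :
    lastRowDet (r + 1) (Pi.single r 1) v = moore r v := by
  unfold lastRowDet moore powDet
  rw [Matrix.det_succ_row _ (Fin.last r), Fin.sum_univ_castSucc, Finset.sum_eq_zero]
  · simp only [Fin.val_last, Matrix.of_apply, if_true, Pi.single_eq_same, zero_add, mul_one]
    rw [Even.neg_one_pow ⟨r, rfl⟩, one_mul]
    congr 1
    ext1 i j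
    have := i.isLt
    simp [this.ne]
  · intro j _
    have : (j : ℕ) ≠ r := j.isLt.ne
    simp [this]

theorem lastRowDet_single (r : ℕ) (v : ℕ → MvPolynomial ℕ F) {j : ℕ} (hj : j < r) :
    lastRowDet (r + 1) (Pi.single j 1) v = - moore r (update v j (v r)) := by
  have h1 : moore r (update v j (v r)) = moore r (v ∘ Equiv.swap j r) := by
    apply powDet_congr
    intro i hi
    by_cases h : i = j
    · subst h; simp
    · simp [h, Equiv.swap_apply_of_ne_of_ne h hi.ne]
  rw [h1, ← lastRowDet_single_last]
  unfold lastRowDet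
  have := Matrix.det_permute' (Equiv.swap (⟨j, by omega⟩ : Fin (r + 1)) (Fin.last r))
    (Matrix.of fun i l : Fin (r + 1) => if (i : ℕ) + 1 = r + 1 then
      (Pi.single j 1 : ℕ → MvPolynomial ℕ F) l else v l ^ q ^ (i : ℕ))
  rw [Equiv.Perm.sign_swap (by simpa [Fin.ext_iff] using hj.ne)] at this
  simp only [Units.val_neg, Units.val_one, Int.cast_neg, Int.cast_one, neg_mul, one_mul] at this
  refine neg_eq_iff_eq_neg.mp (this.symm.trans ?_)
  congr 1
  ext1 k l
  have key : ((Equiv.swap (⟨j, by omega⟩ : Fin (r + 1)) (Fin.last r) l : Fin (r + 1)) : ℕ)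
      = Equiv.swap j r l := by
    simp only [Equiv.swap_apply_def, Fin.ext_iff, Fin.val_last]
    split_ifs <;> rfl
  simp only [Matrix.of_apply, Matrix.submatrix_apply, comp_apply, id, key]
  congr 1
  simp only [Pi.single_apply]
  congr 1
  rw [Equiv.swap_apply_eq_iff, Equiv.swap_apply_left]

/-- Expansion along the last row. Writing the j-th cofactor with v_r moved into slot j replaces the
alternating signs by a uniform minus sign. -/
theorem lastRowDet_succ (r : ℕ) (ρ v : ℕ → MvPolynomial ℕ F) :
    lastRowDet (r + 1) ρ v = ρ r * moore r v
      - ∑ j ∈ Finset.range r, ρ j * moore r (update v j (v r)) := by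
  have h : ∀ j : Fin (r + 1), (Matrix.of fun i l : Fin (r + 1) => if (i : ℕ) + 1 = r + 1 then
      ρ l else v l ^ q ^ (i : ℕ)).adjugate j (Fin.last r)
        = lastRowDet (r + 1) (Pi.single (j : ℕ) 1) v := by
    intro j
    rw [Matrix.adjugate_apply, lastRowDet]
    congr 1
    ext1 k l
    by_cases hk : k = Fin.last r
    · subst hk
      simp [Pi.single_apply, Fin.ext_iff]
    · have : (k : ℕ) ≠ r := fun h' => hk (Fin.ext h')
      simp [hk, this]
  rw [lastRowDet, Matrix.det_eq_sum_mul_adjugate_row _ (Fin.last r), Fin.sum_univ_castSucc,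
    Finset.sum_range]
  simp only [h, Fin.val_last, lastRowDet_single_last, Fin.val_castSucc, lastRowDet_single _ _ (Fin.isLt _)]
  simp
  ring

end

/-! ### The exchange relation and the numerator as an exterior product -/

section

variable {F : Type*} [Field F] [Fintype F]

local notation "q" => Fintype.card F

/-- Alternating functions of the first `r` variables, independent of the next one, that satisfy
the exchange relation for the additive map `x ↦ x ^ q ^ m`. -/
structure AltExch (m r : ℕ) (M : (ℕ → MvPolynomial ℕ F) → MvPolynomial ℕ F) : Prop where
  alt : ∀ v i j, i < r → j < r → i ≠ j → M (v ∘ Equiv.swap i j) = - M v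
  exch : ∀ v c, ∑ i ∈ Finset.range r, v i ^ q ^ m * M (update v i (lin r c v))
    = lin r c v ^ q ^ m * M v
  indep : ∀ v w, M (update v r w) = M v

/-- The product `x ^ q ^ m ∧ M` of the first `r + 1` variables. -/
def wedge (m r : ℕ) (M : (ℕ → MvPolynomial ℕ F) → MvPolynomial ℕ F)
    (v : ℕ → MvPolynomial ℕ F) : MvPolynomial ℕ F :=
  v r ^ q ^ m * M v - ∑ i ∈ Finset.range r, v i ^ q ^ m * M (update v i (v r))

theorem update_update_comp_swap {α : Type*} (v : ℕ → α) {i k : ℕ} (h : i ≠ k) (x y : α) :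
    update (update v i x) k y ∘ Equiv.swap i k = update (update v i y) k x := by
  ext1 l
  by_cases hk : l = k
  · subst hk; simp [h]
  by_cases hi : l = i
  · subst hi; simp [h]
  · simp [hk, hi, Equiv.swap_apply_of_ne_of_ne hi hk]

namespace AltExch

variable {m r : ℕ} {M : (ℕ → MvPolynomial ℕ F) → MvPolynomial ℕ F}

theorem update_update (h : AltExch m r M) {i k : ℕ} (hi : i < r) (hk : k < r) (hik : i ≠ k)
    (v : ℕ → MvPolynomial ℕ F) (x y : MvPolynomial ℕ F) :
    M (update (update v i x) k y) = - M (update (update v k x) i y) := by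
  rw [← neg_eq_iff_eq_neg, ← h.alt _ i k hi hk hik, update_update_comp_swap v hik,
    update_comm hik]

theorem wedge_eq_zero_of_last (h : AltExch m r M) (v : ℕ → MvPolynomial ℕ F) (c : ℕ → F)
    (hv : v r = lin r c v) : wedge m r M v = 0 := by
  rw [wedge, hv, h.exch, sub_self]

/-- The exchange relation is applied after v_r has been put into slot s. Its s-th term is the
leading term of the wedge product, and the alternating property turns the other terms into those of
the sum over i ≠ s. -/
theorem wedge_eq_zero (h : AltExch m r M) (v : ℕ → MvPolynomial ℕ F) (c : ℕ → F) {s : ℕ}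
    (hs : s < r) (hv : v s = lin r c (update v s (v r))) : wedge m r M v = 0 := by
  have h1 := h.exch (update v s (v r)) c
  have hs' := Finset.mem_range.mpr hs
  rw [← hv, ← Finset.add_sum_erase _ _ hs'] at h1
  rw [wedge, ← Finset.add_sum_erase _ _ hs', ← h1]
  simp only [update_self, update_idem, update_eq_self]
  have h2 : ∀ i ∈ (Finset.range r).erase s,
      update v s (v r) i ^ q ^ m * M (update (update v s (v r)) i (v s))
        = - (v i ^ q ^ m * M (update v i (v r))) := by
    intro i hi
    obtain ⟨his, hi⟩ := Finset.mem_erase.mp hi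
    rw [update_of_ne his, h.update_update hs (Finset.mem_range.mp hi) his.symm,
      update_comm his, update_eq_self, mul_neg]
  rw [Finset.sum_congr rfl h2, Finset.sum_neg_distrib]
  ring

theorem wedge_swap (h : AltExch m r M) (v : ℕ → MvPolynomial ℕ F) {i j : ℕ} (hi : i < r)
    (hj : j < r) (hij : i ≠ j) : wedge m r M (v ∘ Equiv.swap i j) = - wedge m r M v := by
  have h1 : (v ∘ Equiv.swap i j) r = v r := by
    simp [Equiv.swap_apply_of_ne_of_ne hi.ne' hj.ne']
  rw [wedge, wedge, h1, h.alt v i j hi hj hij]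
  have h2 : ∑ k ∈ Finset.range r, (v ∘ Equiv.swap i j) k ^ q ^ m
      * M (update (v ∘ Equiv.swap i j) k (v r))
      = ∑ k ∈ Finset.range r, - (v k ^ q ^ m * M (update v k (v r))) := by
    refine Finset.sum_equiv (Equiv.swap i j) ?_ ?_
    · intro k
      simp only [Finset.mem_range, Equiv.swap_apply_def]
      split_ifs <;> omega
    · intro k _
      rw [← mul_neg, ← h.alt _ i j hi hj hij, update_comp_equiv]
      simp
  rw [h2, Finset.sum_neg_distrib]
  ring

/-- The wedge product inherits the exchange relation in the first r variables. Apart from terms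
handled by the relation for M, there remains a double sum antisymmetric in the two replaced slots.
-/
theorem sum_wedge_update (h : AltExch m r M) (v : ℕ → MvPolynomial ℕ F) (c : ℕ → F) :
    ∑ i ∈ Finset.range r, v i ^ q ^ m * wedge m r M (update v i (lin r c v))
      = lin r c v ^ q ^ m * wedge m r M v := by
  set y := lin r c v with hy
  have h1 : ∀ i ∈ Finset.range r, v i ^ q ^ m * wedge m r M (update v i y)
      = v r ^ q ^ m * (v i ^ q ^ m * M (update v i y))
        - y ^ q ^ m * (v i ^ q ^ m * M (update v i (v r)))
        - ∑ k ∈ (Finset.range r).erase i,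
          v i ^ q ^ m * v k ^ q ^ m * M (update (update v i y) k (v r)) := by
    intro i hi
    have hir := (Finset.mem_range.mp hi).ne'
    rw [wedge, ← Finset.add_sum_erase _ _ hi, update_of_ne hir]
    simp only [update_self, update_idem]
    have h2 : ∀ k ∈ (Finset.range r).erase i,
        update v i y k ^ q ^ m * M (update (update v i y) k (v r))
          = v k ^ q ^ m * M (update (update v i y) k (v r)) := by
      intro k hk
      rw [update_of_ne (Finset.mem_erase.mp hk).1]
    rw [Finset.sum_congr rfl h2]
    simp only [mul_assoc, ← Finset.mul_sum]
    ring
  have h3 : ∑ i ∈ Finset.range r, ∑ k ∈ (Finset.range r).erase i,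
      v i ^ q ^ m * v k ^ q ^ m * M (update (update v i y) k (v r)) = 0 := by
    rw [Finset.sum_sigma']
    -- Pairing (i, k) with (k, i) has no fixed points, so the cancellation is valid in
    -- characteristic 2 as well.
    refine Finset.sum_involution (fun p _ => ⟨p.2, p.1⟩) ?_ ?_ ?_ ?_
    · rintro ⟨i, k⟩ hp
      simp only [Finset.mem_sigma, Finset.mem_range, Finset.mem_erase] at hp
      simp only
      rw [h.update_update hp.1 hp.2.2 hp.2.1.symm]
      ring
    · rintro ⟨i, k⟩ hp _ heq
      simp only [Finset.mem_sigma, Finset.mem_range, Finset.mem_erase] at hp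
      simp only [Sigma.mk.injEq] at heq
      exact hp.2.1 heq.1
    · rintro ⟨i, k⟩ hp
      simp only [Finset.mem_sigma, Finset.mem_range, Finset.mem_erase] at hp ⊢
      exact ⟨hp.2.2, hp.2.1.symm, hp.1⟩
    · rintro ⟨i, k⟩ _
      rfl
  rw [Finset.sum_congr rfl h1, Finset.sum_sub_distrib, Finset.sum_sub_distrib, h3,
    ← Finset.mul_sum, ← Finset.mul_sum, h.exch, wedge]
  ring

end AltExch

/-- Polynomials that are symmetric in the first `r` variables and satisfy the exchange relation
for the additive map `x ↦ x ^ q ^ m`. -/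
structure Good (m r : ℕ) (f : MvPolynomial ℕ F) : Prop where
  symm : ∀ i j, i < r → j < r → ∀ v : ℕ → MvPolynomial ℕ F,
    aeval (v ∘ Equiv.swap i j) f = aeval v f
  exch : ∀ (v : ℕ → MvPolynomial ℕ F) (c : ℕ → F),
    ∑ i ∈ Finset.range r, c i • (v i ^ q ^ m * aeval (update v i (lin r c v)) f)
      = lin r c v ^ q ^ m * aeval v f

theorem good_one (m r : ℕ) : Good (F := F) m r 1 where
  symm i j _ _ v := by simp
  exch v c := by
    rw [lin_pow_card]
    simp [lin]

theorem moore_congr {r : ℕ} {v w : ℕ → MvPolynomial ℕ F} (h : ∀ i < r, v i = w i) :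
    moore r v = moore r w :=
  powDet_congr h

namespace Good

variable {m r : ℕ} {f : MvPolynomial ℕ F}

theorem mono (h : Good m (r + 1) f) : Good m r f where
  symm i j hi hj v := h.symm i j (by omega) (by omega) v
  exch v c := by
    have h1 := h.exch v (fun i => if i < r then c i else 0)
    have h2 : lin (r + 1) (fun i => if i < r then c i else 0) v = lin r c v := by
      rw [lin, Finset.sum_range_succ]
      simp only [lt_irrefl, if_false, zero_smul, add_zero]
      exact Finset.sum_congr rfl fun i hi => by simp [Finset.mem_range.mp hi]
    rw [h2, Finset.sum_range_succ] at h1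
    simp only [lt_irrefl, if_false, zero_smul, add_zero] at h1
    rw [← h1]
    exact Finset.sum_congr rfl fun i hi => by simp [Finset.mem_range.mp hi]

/-- Terms with c_i = 0 drop out of the exchange relation, so d has to be invariant only under the
invertible substitutions. -/
theorem mul_of_invariant (h : Good m r f) {d : MvPolynomial ℕ F}
    (hs : ∀ i j, i < r → j < r → ∀ v : ℕ → MvPolynomial ℕ F,
      aeval (v ∘ Equiv.swap i j) d = aeval v d)
    (hd : ∀ (v : ℕ → MvPolynomial ℕ F) (c : ℕ → F) (i : ℕ), i < r → c i ≠ 0 →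
      aeval (update v i (lin r c v)) d = aeval v d) : Good m r (d * f) where
  symm i j hi hj v := by rw [map_mul, map_mul, hs i j hi hj, h.symm i j hi hj]
  exch v c := by
    rw [map_mul, mul_left_comm, ← h.exch, Finset.mul_sum]
    refine Finset.sum_congr rfl fun i hi => ?_
    by_cases hc : c i = 0
    · simp [hc]
    · rw [map_mul, hd v c i (Finset.mem_range.mp hi) hc, mul_left_comm, mul_smul_comm]

/-- Leaving out v_j or leaving out v_r with v_r placed in slot j gives the same first r arguments up
to order, so symmetry suffices. The induction moves v_r by adjacent transpositions. -/
theorem aeval_comp_skip (h : Good m r f) {j : ℕ} (hj : j ≤ r) (v : ℕ → MvPolynomial ℕ F) :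
    aeval (v ∘ skip j) f = aeval (update v j (v r) ∘ skip r) f := by
  obtain ⟨d, rfl⟩ := Nat.exists_eq_add_of_le hj
  clear hj
  induction d generalizing j v with
  | zero => simp
  | succ d ih =>
    rcases Nat.eq_zero_or_pos d with rfl | hd
    · congr 2
      ext1 k
      simp only [comp_apply, update_apply, skip]
      split_ifs <;> first | rfl | omega | (congr 1; omega)
    · have h1 : v ∘ skip j = update v j (v (j + 1)) ∘ skip (j + 1) := by
        ext1 k
        simp only [comp_apply, update_apply, skip]
        split_ifs <;> first | rfl | omega | (congr 1; omega)
      have h2 := ih (j := j + 1) (v := update v j (v (j + 1)))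
        (by rwa [show j + 1 + d = j + (d + 1) by omega])
      rw [h1, h2, ← h.symm j (j + 1) (by omega) (by omega)]
      congr 2
      ext1 k
      simp only [comp_apply, update_apply, skip, Equiv.swap_apply_def]
      split_ifs <;> first | rfl | omega | (congr 1; omega)

/-- Replacing v_i by the combination multiplies the Moore determinant by c_i. This absorbs the
weights c_i of `Good.exch` and yields the unweighted relation. -/
theorem altExch (h : Good m r f) :
    AltExch m r (fun v : ℕ → MvPolynomial ℕ F => moore r v * aeval (v ∘ skip r) f) where
  alt v i j hi hj hij := by
    have : (v ∘ Equiv.swap i j) ∘ skip r = (v ∘ skip r) ∘ Equiv.swap i j := by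
      ext1 k
      simp only [comp_apply, skip, Equiv.swap_apply_def]
      split_ifs <;> first | rfl | omega
    simp only [this]
    rw [h.symm i j hi hj, moore, powDet_swap _ _ _ hi hj hij, moore]
    ring
  exch v c := by
    have h1 := h.exch (v ∘ skip r) c
    rw [lin_comp_skip] at h1
    rw [mul_left_comm, ← h1, Finset.mul_sum]
    refine Finset.sum_congr rfl fun i hi => ?_
    have hi' := Finset.mem_range.mp hi
    rw [moore, powDet_update_lin _ _ _ _ hi', update_comp_skip _ _ hi', moore]
    simp only [comp_apply, skip, hi', if_true, smul_mul_assoc, mul_smul_comm]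
    congr 1
    ring
  indep v w := by
    have h1 : update v r w ∘ skip r = v ∘ skip r := by
      ext1 k
      simp only [comp_apply, update_apply, skip]
      split_ifs <;> first | rfl | omega
    have h2 : moore r (update v r w) = moore r v := moore_congr fun i hi => by simp [hi.ne]
    simp only [h1, h2]

end Good

/-- The numerator of `δ_{a;b}(f)`, evaluated at `v`. -/
def numer (a b : ℕ) (f : MvPolynomial ℕ F) (v : ℕ → MvPolynomial ℕ F) : MvPolynomial ℕ F :=
  lastRowDet a (fun j => v j ^ q ^ b * aeval (v ∘ skip j) f) v

theorem aeval_numer (w v : ℕ → MvPolynomial ℕ F) (a b : ℕ) (f : MvPolynomial ℕ F) :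
    aeval w (numer a b f v) = numer a b f (fun i => aeval w (v i)) := by
  unfold numer lastRowDet
  rw [AlgHom.map_det]
  congr 1
  ext1 i j
  simp only [AlgHom.mapMatrix_apply, Matrix.map_apply, Matrix.of_apply]
  split_ifs
  · rw [map_mul, map_pow, aeval_aeval_apply]
    rfl
  · simp

theorem aeval_moore (w v : ℕ → MvPolynomial ℕ F) (r : ℕ) :
    aeval w (moore r v) = moore r (fun i => aeval w (v i)) :=
  aeval_powDet _ _ _ _

theorem Good.numer_eq_wedge {m r : ℕ} {f : MvPolynomial ℕ F} (h : Good m r f)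
    (v : ℕ → MvPolynomial ℕ F) :
    numer (r + 1) m f v = wedge m r (fun v => moore r v * aeval (v ∘ skip r) f) v := by
  rw [numer, lastRowDet_succ, wedge]
  congr 1
  · ring
  · refine Finset.sum_congr rfl fun i hi => ?_
    rw [h.aeval_comp_skip (Finset.mem_range.mp hi).le]
    ring

end

/-! ### Restriction to the hyperplane x₁ = 0 -/

section

variable {F : Type*} [Field F]

/-- The substitution `x₁ ↦ 0`, `x_{i+1} ↦ x_i`. -/
def dropVar : MvPolynomial ℕ F →ₐ[F] MvPolynomial ℕ F :=
  aeval fun i => Nat.casesOn i 0 X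

@[simp]
theorem dropVar_X_zero : dropVar (X 0 : MvPolynomial ℕ F) = 0 := by simp [dropVar]

@[simp]
theorem dropVar_X_succ (i : ℕ) : dropVar (X (i + 1) : MvPolynomial ℕ F) = X i := by simp [dropVar]

theorem dropVar_aeval_skip_succ (j : ℕ) (f : MvPolynomial ℕ F) :
    dropVar (aeval ((X : ℕ → MvPolynomial ℕ F) ∘ skip (j + 1)) f)
      = aeval ((X : ℕ → MvPolynomial ℕ F) ∘ skip j) (dropVar f) := by
  rw [dropVar, aeval_aeval_apply, aeval_aeval_apply]
  congr 2
  ext1 i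
  rcases i with _ | i
  · simp [skip]
  · by_cases h : i < j <;> simp [skip, h]

variable [Fintype F]

local notation "q" => Fintype.card F

/-- The first column is divisible by x_1. After division and restriction it becomes (1, 0, …, 0),
and the complementary minor is the smaller numerator with Frobenius applied to each entry. -/
theorem numer_drop (r m : ℕ) {f h : MvPolynomial ℕ F} (hf : dropVar f = h ^ q) :
    ∃ N : MvPolynomial ℕ F, numer (r + 2) (m + 1) f X = X 0 * N ∧
      dropVar N = numer (r + 1) m h X ^ q := by
  set A : Matrix (Fin (r + 2)) (Fin (r + 2)) (MvPolynomial ℕ F) := Matrix.of fun i j =>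
    if (i : ℕ) + 1 = r + 2 then X (j : ℕ) ^ q ^ (m + 1) * aeval (X ∘ skip j) f
    else X (j : ℕ) ^ q ^ (i : ℕ) with hA
  have hq : 1 < q := Fintype.one_lt_card
  have hpos : ∀ n, 0 < q ^ n := fun n => pow_pos (by omega) n
  set u : Fin (r + 2) → MvPolynomial ℕ F := fun i =>
    if (i : ℕ) + 1 = r + 2 then X 0 ^ (q ^ (m + 1) - 1) * aeval (X ∘ skip 0) f
    else X 0 ^ (q ^ (i : ℕ) - 1) with hu
  refine ⟨(A.updateCol 0 u).det, ?_, ?_⟩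
  · rw [← Matrix.det_updateCol_smul]
    change A.det = _
    congr 1
    ext1 i j
    by_cases hj : j = 0
    · subst hj
      rw [Matrix.updateCol_self, hA, hu]
      simp only [Matrix.of_apply, Pi.smul_apply, smul_eq_mul, Fin.val_zero]
      split_ifs
      · rw [← mul_assoc, ← pow_succ', Nat.sub_add_cancel (hpos _)]
      · rw [← pow_succ', Nat.sub_add_cancel (hpos _)]
    · rw [Matrix.updateCol_ne hj]
  · rw [AlgHom.map_det, Matrix.det_succ_column_zero, Fin.sum_univ_succ, Finset.sum_eq_zero]
    · have h2 : numer (r + 1) m h X ^ q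
          = FiniteField.frobeniusAlgHom F (MvPolynomial ℕ F) (numer (r + 1) m h X) := rfl
      rw [h2, numer, lastRowDet, AlgHom.map_det, add_zero]
      have h3 : dropVar (u 0) = 1 := by simp [hu]
      simp only [Fin.val_zero, pow_zero, one_mul, AlgHom.mapMatrix_apply, Matrix.map_apply,
        Matrix.updateCol_self, h3]
      congr 1
      ext1 i j
      have hj : Fin.succ j ≠ 0 := Fin.succ_ne_zero j
      simp only [Matrix.submatrix_apply, Matrix.map_apply, Fin.zero_succAbove, Matrix.updateCol_ne hj,
        hA, Matrix.of_apply, Fin.val_succ, Nat.add_right_cancel_iff,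
        FiniteField.coe_frobeniusAlgHom]
      by_cases hi : (i : ℕ) = r
      · simp only [hi, if_true, map_mul, map_pow, dropVar_X_succ, dropVar_aeval_skip_succ, hf]
        rw [mul_pow, pow_succ, pow_mul]
      · simp only [hi, if_false, map_pow, dropVar_X_succ]
        rw [pow_succ, pow_mul]
    · intro i _
      have h3 : dropVar (u i.succ) = 0 := by
        -- Below the top row the exponent of x_1 is still positive after division. In the last row
        -- this is where m + 1 rather than m is needed.
        have h4 : ∀ n, q ^ (n + 1) - 1 ≠ 0 := by
          intro n
          have : 1 < q ^ (n + 1) := Nat.one_lt_pow (by omega) hq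
          omega
        simp only [hu, Fin.val_succ]
        split_ifs <;> simp [h4]
      simp [h3]

theorem moore_eq_numer (r : ℕ) (v : ℕ → MvPolynomial ℕ F) :
    moore (r + 1) v = numer (r + 1) r 1 v := by
  unfold moore numer powDet lastRowDet
  congr 1
  ext1 i j
  simp only [Matrix.of_apply, map_one, mul_one, Nat.add_right_cancel_iff, id]
  split_ifs with h
  · rw [h]
  · rfl

theorem moore_drop (r : ℕ) :
    ∃ N : MvPolynomial ℕ F, moore (r + 2) X = X 0 * N ∧ dropVar N = moore (r + 1) X ^ q := by
  rw [moore_eq_numer, moore_eq_numer]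
  exact numer_drop r r (by simp)

theorem moore_one (v : ℕ → MvPolynomial ℕ F) : moore 1 v = v 0 := by
  simp [moore, powDet]

theorem moore_X_ne_zero (r : ℕ) : moore r (X : ℕ → MvPolynomial ℕ F) ≠ 0 := by
  rcases r with _ | r
  · simp [moore, powDet]
  induction r with
  | zero => rw [moore_one]; exact X_ne_zero 0
  | succ r ih =>
    obtain ⟨N, h1, h2⟩ := moore_drop (F := F) r
    rw [h1]
    refine mul_ne_zero (X_ne_zero 0) fun h => ?_
    rw [h, map_zero] at h2
    exact pow_ne_zero _ ih h2.symm

/-- The restriction of `δ_{a+1;m+1}(f)` to the hyperplane `x₁ = 0`. -/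
theorem dropVar_quotient {r m : ℕ} {f h g g' : MvPolynomial ℕ F} (hf : dropVar f = h ^ q)
    (hg : numer (r + 2) (m + 1) f X = moore (r + 2) X * g)
    (hg' : numer (r + 1) m h X = moore (r + 1) X * g') : dropVar g = g' ^ q := by
  obtain ⟨N, h1, h2⟩ := numer_drop r m hf
  obtain ⟨L, h3, h4⟩ := moore_drop (F := F) r
  rw [h1, h3, mul_assoc] at hg
  have h5 := congrArg dropVar (mul_left_cancel₀ (X_ne_zero 0) hg)
  rw [map_mul, h2, h4, hg', mul_pow] at h5
  exact (mul_left_cancel₀ (pow_ne_zero _ (moore_X_ne_zero _)) h5).symm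

end

/-! ### Linear forms and divisibility by the Moore determinant -/

section

variable {F : Type*} [Field F]

/-- The linear form `x_s - ∑_{i < s} c_i x_i`. -/
def linForm (s : ℕ) (c : ℕ → F) : MvPolynomial ℕ F := X s - lin s c X

theorem aeval_linForm (s : ℕ) (c : ℕ → F) (v : ℕ → MvPolynomial ℕ F) :
    aeval v (linForm s c) = v s - lin s c v := by
  rw [linForm, map_sub, aeval_lin]
  simp


/-- The hypothesis says that the substitution x_s ↦ p fixes p. Modulo x_s - p, every polynomial is
congruent to its image under this substitution. -/
theorem sub_dvd_iff {s : ℕ} {p : MvPolynomial ℕ F}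
    (hp : aeval (update (X : ℕ → MvPolynomial ℕ F) s p) p = p) (f : MvPolynomial ℕ F) :
    X s - p ∣ f ↔ aeval (update X s p) f = 0 := by
  constructor
  · rintro ⟨g, rfl⟩
    rw [map_mul, map_sub, hp]
    simp
  · intro h
    rw [← sub_zero f, ← h, ← Ideal.mem_span_singleton, ← Ideal.Quotient.mk_eq_mk_iff_sub_mem]
    set π := Ideal.Quotient.mkₐ F (Ideal.span {X s - p}) with hπ
    change π f = π (aeval (update X s p) f)
    have : π = π.comp (aeval (update X s p)) := by
      refine algHom_ext fun i => ?_
      by_cases hi : i = s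
      · subst hi
        rw [AlgHom.comp_apply, aeval_X, update_self]
        exact Ideal.Quotient.mk_eq_mk_iff_sub_mem _ _ |>.mpr (Ideal.mem_span_singleton_self _)
      · simp [hi]
    rw [← AlgHom.comp_apply, ← this]

theorem lin_update {s : ℕ} (c : ℕ → F) (v : ℕ → MvPolynomial ℕ F) {j : ℕ} (hj : s ≤ j)
    (y : MvPolynomial ℕ F) : lin s c (update v j y) = lin s c v :=
  lin_congr fun i hi => by rw [update_of_ne (by omega)]

theorem linForm_dvd_iff (s : ℕ) (c : ℕ → F) (f : MvPolynomial ℕ F) :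
    linForm s c ∣ f ↔ aeval (update X s (lin s c X)) f = 0 := by
  refine sub_dvd_iff ?_ f
  rw [aeval_lin]
  simp only [aeval_X]
  exact lin_update c X le_rfl _

theorem linForm_ne_zero (s : ℕ) (c : ℕ → F) : linForm s c ≠ 0 := by
  intro h
  have h1 := congrArg (aeval (update (X : ℕ → MvPolynomial ℕ F) s (lin s c X + 1))) h
  rw [aeval_linForm, lin_update c X le_rfl, update_self, map_zero] at h1
  simp at h1

theorem linForm_prime (s : ℕ) (c : ℕ → F) : Prime (linForm s c) := by
  refine ⟨linForm_ne_zero s c, fun h => ?_, fun f g h => ?_⟩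
  · have h1 := (linForm_dvd_iff s c 1).mp h.dvd
    simp at h1
  · simpa only [linForm_dvd_iff, map_mul, mul_eq_zero] using h

theorem linForm_not_dvd_of_lt {s t : ℕ} (hst : s < t) (c d : ℕ → F) :
    ¬ linForm s c ∣ linForm t d := by
  intro h
  -- At the t-th basis vector the first form takes the value 0 and the second the value 1.
  have h1 := map_dvd (aeval (Pi.single t 1 : ℕ → MvPolynomial ℕ F)) h
  rw [aeval_linForm, aeval_linForm] at h1
  have h2 : ∀ (r : ℕ) (c : ℕ → F), r ≤ t → lin r c (Pi.single t 1) = 0 := by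
    intro r c hr
    refine Finset.sum_eq_zero fun i hi => ?_
    have := Finset.mem_range.mp hi
    rw [Pi.single_eq_of_ne (by omega), smul_zero]
  simp [h2 s c hst.le, h2 t d le_rfl, hst.ne] at h1

theorem eq_of_linForm_dvd {s : ℕ} {c d : ℕ → F} (h : linForm s c ∣ linForm s d) {i : ℕ}
    (hi : i < s) : c i = d i := by
  rw [linForm_dvd_iff, aeval_linForm, lin_update d X le_rfl, update_self, sub_eq_zero] at h
  have h1 := congrArg (aeval (Pi.single i 1 : ℕ → MvPolynomial ℕ F)) h
  have h2 : ∀ c : ℕ → F, lin s c (Pi.single i 1) = C (c i) := by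
    intro c
    rw [lin, Finset.sum_eq_single i]
    · simp [smul_eq_C_mul]
    · intro j _ hj
      simp [hj]
    · simp [hi]
  simp only [aeval_lin, aeval_X, h2] at h1
  exact C_injective _ _ h1

theorem linForm_isRelPrime {s t : ℕ} {c d : ℕ → F} (h : s = t → ∃ i < s, c i ≠ d i) :
    IsRelPrime (linForm s c) (linForm t d) := by
  rcases lt_trichotomy s t with hst | rfl | hst
  · rw [(linForm_prime s c).irreducible.isRelPrime_iff_not_dvd]
    exact linForm_not_dvd_of_lt hst c d
  · rw [(linForm_prime s c).irreducible.isRelPrime_iff_not_dvd]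
    obtain ⟨i, hi, hne⟩ := h rfl
    exact fun h' => hne (eq_of_linForm_dvd h' hi)
  · refine IsRelPrime.symm ?_
    rw [(linForm_prime t d).irreducible.isRelPrime_iff_not_dvd]
    exact linForm_not_dvd_of_lt hst d c

theorem linForm_isHomogeneous (s : ℕ) (c : ℕ → F) : (linForm s c).IsHomogeneous 1 := by
  refine (isHomogeneous_X F s).sub (IsHomogeneous.sum _ _ _ fun i _ => ?_)
  rw [smul_eq_C_mul]
  exact isHomogeneous_C_mul_X _ _

/-- Extension of a vector by zero. -/
def extendZero {s : ℕ} (c : Fin s → F) (i : ℕ) : F := if h : i < s then c ⟨i, h⟩ else 0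

variable [Fintype F]

local notation "q" => Fintype.card F

-- The forms are pairwise coprime primes; `extendZero` makes each of them occur exactly once in the
-- product.
open Classical in
theorem prod_linForm_dvd (a : ℕ) {f : MvPolynomial ℕ F}
    (h : ∀ s < a, ∀ c : ℕ → F, aeval (update X s (lin s c X)) f = 0) :
    ∏ p : (s : Fin a) × (Fin s → F), linForm p.1 (extendZero p.2) ∣ f := by
  refine Fintype.prod_dvd_of_isRelPrime ?_ fun p => ?_
  · rintro ⟨s, c⟩ ⟨t, d⟩ hne
    refine linForm_isRelPrime fun hst => ?_
    obtain rfl := Fin.ext hst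
    obtain ⟨i, hi⟩ := Function.ne_iff.mp fun h' : c = d => hne (h' ▸ rfl)
    exact ⟨i, i.isLt, by simpa [extendZero] using hi⟩
  · rw [linForm_dvd_iff]
    exact h _ p.1.isLt _

omit [Fintype F] in
theorem isHomogeneous_det {n d : ℕ} {A : Matrix (Fin n) (Fin n) (MvPolynomial ℕ F)}
    {e : Fin n → ℕ} (h : ∀ i j, (A i j).IsHomogeneous (e i)) (hd : ∑ i, e i = d) :
    A.det.IsHomogeneous d := by
  subst hd
  rw [← Matrix.det_transpose, Matrix.det_apply]
  refine IsHomogeneous.sum _ _ _ fun σ _ => ?_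
  have h1 : (∏ i, A.transpose (σ i) i).IsHomogeneous (∑ i, e i) :=
    IsHomogeneous.prod _ _ _ fun i _ => h _ _
  rw [Units.smul_def, zsmul_eq_mul]
  rcases Int.units_eq_one_or (Equiv.Perm.sign σ) with hs | hs <;> simp only [hs]
  · simpa using h1
  · simpa using h1.neg

theorem moore_isHomogeneous (a : ℕ) :
    (moore a (X : ℕ → MvPolynomial ℕ F)).IsHomogeneous (∑ i : Fin a, q ^ (i : ℕ)) :=
  isHomogeneous_det (fun _ _ => isHomogeneous_X_pow _ _) rfl

/-- A polynomial that vanishes on all the hyperplanes `x_s = ∑_{i < s} c_i x_i` for `s < a` is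
divisible by the Moore determinant. -/
theorem moore_dvd (a : ℕ) {f : MvPolynomial ℕ F}
    (h : ∀ s < a, ∀ c : ℕ → F, aeval (update X s (lin s c X)) f = 0) :
    moore a (X : ℕ → MvPolynomial ℕ F) ∣ f := by
  classical
  refine dvd_trans ?_ (prod_linForm_dvd a h)
  have h0 : ∀ s < a, ∀ c : ℕ → F,
      aeval (update X s (lin s c X)) (moore a (X : ℕ → MvPolynomial ℕ F)) = 0 := by
    intro s hs c
    rw [aeval_moore]
    simp only [aeval_X]
    have h2 : lin s c X = lin a (fun i => if i < s then c i else 0) (X : ℕ → MvPolynomial ℕ F) := by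
      rw [lin, lin, ← Finset.sum_subset (Finset.range_subset_range.mpr hs.le)]
      · exact Finset.sum_congr rfl fun i hi => by simp [Finset.mem_range.mp hi]
      · intro i _ hi
        simp [Finset.mem_range.not.mp hi]
    rw [h2, moore, powDet_update_lin _ _ _ _ hs]
    simp
  -- The Moore determinant vanishes on the same hyperplanes. There are q^s forms for each s, so the
  -- product has the degree of the Moore determinant, and the cofactor u is a nonzero constant.
  obtain ⟨u, hu⟩ := prod_linForm_dvd a h0
  have hne := moore_X_ne_zero (F := F) a
  have hp : (∏ p : (s : Fin a) × (Fin s → F), linForm (p.1 : ℕ) (extendZero p.2)).IsHomogeneous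
      (∑ i : Fin a, q ^ (i : ℕ)) := by
    have := IsHomogeneous.prod Finset.univ
      (fun p : (s : Fin a) × (Fin s → F) => linForm (p.1 : ℕ) (extendZero p.2)) (fun _ => 1)
      fun p _ => linForm_isHomogeneous _ _
    simpa [Fintype.card_sigma] using this
  have hdeg := (moore_isHomogeneous (F := F) a).totalDegree hne
  rw [hu] at hne
  have hpne := left_ne_zero_of_mul hne
  have hune := right_ne_zero_of_mul hne
  rw [hu, totalDegree_mul_of_isDomain hpne hune, hp.totalDegree hpne] at hdeg
  have hu0 : u = C (coeff 0 u) := totalDegree_eq_zero_iff_eq_C.mp (by omega)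
  have hc : coeff 0 u ≠ 0 := fun h' => hune (by rw [hu0, h', map_zero])
  have hunit : IsUnit u := by
    rw [hu0]
    exact (IsUnit.mk0 _ hc).map C
  rw [hu]
  exact hunit.mul_right_dvd.mpr dvd_rfl

theorem Good.moore_dvd_numer {m r : ℕ} {f : MvPolynomial ℕ F} (h : Good m r f) :
    moore (r + 1) (X : ℕ → MvPolynomial ℕ F) ∣ numer (r + 1) m f X := by
  refine moore_dvd _ fun s hs c => ?_
  rw [aeval_numer, h.numer_eq_wedge]
  simp only [aeval_X]
  rcases Nat.lt_succ_iff_lt_or_eq.mp hs with hs | rfl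
  · refine h.altExch.wedge_eq_zero _ (fun i => if i < s then c i else 0) hs ?_
    rw [update_self, lin, lin, ← Finset.sum_subset (Finset.range_subset_range.mpr hs.le)]
    · refine Finset.sum_congr rfl fun i hi => ?_
      have := Finset.mem_range.mp hi
      simp [this, this.ne]
    · intro i _ hi
      simp [Finset.mem_range.not.mp hi]
  · refine h.altExch.wedge_eq_zero_of_last _ c ?_
    rw [update_self, lin_update c X le_rfl]

/-- `δ_{r+1;m}` preserves the class of polynomials `Good m r`. -/
theorem Good.quotient {m r : ℕ} {f g : MvPolynomial ℕ F} (h : Good m r f)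
    (hg : numer (r + 1) m f X = moore (r + 1) X * g) : Good m r g := by
  -- Both properties of g follow from the corresponding ones of the wedge product at the generic
  -- point, by cancelling the Moore determinant, and are then specialised to v.
  have hgv : ∀ v : ℕ → MvPolynomial ℕ F,
      wedge m r (fun v => moore r v * aeval (v ∘ skip r) f) v = moore (r + 1) v * aeval v g := by
    intro v
    have := congrArg (aeval v) hg
    rw [map_mul, aeval_numer, aeval_moore] at this
    simpa only [aeval_X, h.numer_eq_wedge] using this
  have hne := moore_X_ne_zero (F := F) (r + 1)
  constructor
  · intro i j hi hj
    rcases eq_or_ne i j with rfl | hij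
    · intro v
      simp
    have h1 : aeval (X ∘ Equiv.swap i j) g = g := by
      have := h.altExch.wedge_swap X hi hj hij
      rw [hgv, hgv, moore, powDet_swap _ _ _ (by omega) (by omega) hij, neg_mul, neg_inj] at this
      simpa using mul_left_cancel₀ hne this
    intro v
    conv_rhs => rw [← h1, aeval_aeval_apply]
    simp [Function.comp_def]
  · intro v c
    have h1 : ∑ i ∈ Finset.range r, c i • (X i ^ q ^ m * aeval (update X i (lin r c X)) g)
        = lin r c X ^ q ^ m * g := by
      have := h.altExch.sum_wedge_update X c
      refine mul_left_cancel₀ hne ?_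
      rw [hgv, aeval_X_left_apply, mul_left_comm] at this
      rw [← this, Finset.mul_sum]
      refine Finset.sum_congr rfl fun i hi => ?_
      have hi' := Finset.mem_range.mp hi
      have h2 : moore (r + 1) (update X i (lin r c X)) = c i • moore (r + 1) X := by
        have h3 : lin r c X = lin (r + 1) (fun i => if i < r then c i else 0)
            (X : ℕ → MvPolynomial ℕ F) := by
          rw [lin, lin, Finset.sum_range_succ]
          simp only [lt_irrefl, if_false, zero_smul, add_zero]
          exact Finset.sum_congr rfl fun i hi => by simp [Finset.mem_range.mp hi]
        rw [h3, moore, powDet_update_lin _ _ _ _ (by omega), if_pos hi']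
        rfl
      rw [hgv, h2, mul_smul_comm, smul_mul_assoc, mul_smul_comm]
      congr 1
      ring
    have h2 := congrArg (aeval v) h1
    rw [map_mul, map_pow, aeval_lin, map_sum] at h2
    simp only [aeval_X] at h2
    rw [← h2]
    refine Finset.sum_congr rfl fun i _ => ?_
    rw [map_smul, map_mul, map_pow, aeval_aeval_apply, aeval_update, aeval_lin]
    simp only [aeval_X]

end

/-! ### The polynomials representing δ, D and Y -/

section

variable {F : Type*} [Field F]

theorem omitVar_algebraMap (j : ℕ) (f : MvPolynomial ℕ F) :
    omitVar j (algebraMap (MvPolynomial ℕ F) (RatFun F) f)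
      = algebraMap (MvPolynomial ℕ F) (RatFun F) (aeval ((X : ℕ → MvPolynomial ℕ F) ∘ skip j) f) := by
  unfold omitVar IsFractionRing.map
  rw [IsLocalization.map_eq]
  change algebraMap _ _ (rename (skip j) f) = _
  rw [rename_eq_aeval]

variable [Fintype F]

local notation "q" => Fintype.card F

theorem delta_algebraMap {a b : ℕ} {f g : MvPolynomial ℕ F}
    (h : numer a b f X = moore a X * g) :
    delta a b (algebraMap (MvPolynomial ℕ F) (RatFun F) f) = algebraMap _ _ g := by
  have h1 : (deltaNum a b (algebraMap (MvPolynomial ℕ F) (RatFun F) f)).det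
      = algebraMap _ _ (numer a b f X) := by
    unfold numer lastRowDet
    rw [RingHom.map_det]
    congr 1
    ext1 i j
    simp only [deltaNum, RingHom.mapMatrix_apply, Matrix.map_apply, Matrix.of_apply,
      omitVar_algebraMap, var]
    split_ifs <;> simp
  have h2 : (deltaDen F a).det = algebraMap _ _ (moore a (X : ℕ → MvPolynomial ℕ F)) := by
    unfold moore powDet
    rw [RingHom.map_det]
    congr 1
    ext1 i j
    simp [deltaDen, var]
  rw [delta, h1, h2, h, map_mul, mul_div_cancel_left₀]
  rw [Ne, map_eq_zero_iff _ (IsFractionRing.injective (MvPolynomial ℕ F) (RatFun F))]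
  exact moore_X_ne_zero a

open Classical in
/-- The operator `δ_{a;b}` on those polynomials whose image is a polynomial. -/
def deltaPoly (a b : ℕ) (f : MvPolynomial ℕ F) : MvPolynomial ℕ F :=
  if h : moore a X ∣ numer a b f X then h.choose else 0

theorem Good.numer_eq {m r : ℕ} {f : MvPolynomial ℕ F} (h : Good m r f) :
    numer (r + 1) m f X = moore (r + 1) X * deltaPoly (r + 1) m f := by
  rw [deltaPoly, dif_pos h.moore_dvd_numer]
  exact h.moore_dvd_numer.choose_spec

theorem Good.deltaPoly {m r : ℕ} {f : MvPolynomial ℕ F} (h : Good m r f) :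
    Good m r (deltaPoly (r + 1) m f) :=
  h.quotient h.numer_eq

theorem Good.iterate_deltaPoly {m r : ℕ} {f : MvPolynomial ℕ F} (h : Good m r f) (i : ℕ) :
    Good m r ((BorelInv.deltaPoly (r + 1) m)^[i] f) ∧
      (delta (r + 1) m)^[i] (algebraMap (MvPolynomial ℕ F) (RatFun F) f)
        = algebraMap _ _ ((BorelInv.deltaPoly (r + 1) m)^[i] f) := by
  induction i with
  | zero => exact ⟨h, rfl⟩
  | succ i ih =>
    rw [iterate_succ_apply', iterate_succ_apply', ih.2, delta_algebraMap ih.1.numer_eq]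
    exact ⟨ih.1.deltaPoly, rfl⟩

/-- `D_a` as a polynomial. -/
def dicksonPoly (F : Type*) [Field F] [Fintype F] (a : ℕ) : MvPolynomial ℕ F := deltaPoly a a 1

theorem dicksonPoly_spec (r : ℕ) :
    numer (r + 1) (r + 1) 1 (X : ℕ → MvPolynomial ℕ F)
      = moore (r + 1) X * dicksonPoly F (r + 1) :=
  (good_one (r + 1) r).numer_eq

theorem algebraMap_dicksonPoly (r : ℕ) :
    algebraMap (MvPolynomial ℕ F) (RatFun F) (dicksonPoly F (r + 1)) = dickson F (r + 1) := by
  rw [dickson, ← map_one (algebraMap (MvPolynomial ℕ F) (RatFun F)),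
    delta_algebraMap (dicksonPoly_spec r)]

/-- Exhibits D_{r+1} as a ratio of two determinants that change by the same factor under swaps and
linear substitutions; its invariance follows. -/
theorem powDet_eq_moore_mul_dicksonPoly (r : ℕ) (v : ℕ → MvPolynomial ℕ F) :
    powDet (r + 1) (fun i => if i = r then r + 1 else i) v
      = moore (r + 1) v * aeval v (dicksonPoly F (r + 1)) := by
  have h := congrArg (aeval v) (dicksonPoly_spec (F := F) r)
  rw [map_mul, aeval_numer, aeval_moore] at h
  simp only [aeval_X] at h
  rw [← h]
  unfold numer powDet lastRowDet
  congr 1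
  ext1 i j
  simp only [Matrix.of_apply, map_one, mul_one, Nat.add_right_cancel_iff]
  split_ifs <;> rfl

theorem dicksonPoly_swap (r : ℕ) {i j : ℕ} (hi : i < r + 1) (hj : j < r + 1)
    (v : ℕ → MvPolynomial ℕ F) :
    aeval (v ∘ Equiv.swap i j) (dicksonPoly F (r + 1)) = aeval v (dicksonPoly F (r + 1)) := by
  rcases eq_or_ne i j with rfl | hij
  · simp
  have h1 : aeval ((X : ℕ → MvPolynomial ℕ F) ∘ Equiv.swap i j) (dicksonPoly F (r + 1))
      = dicksonPoly F (r + 1) := by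
    have h := powDet_eq_moore_mul_dicksonPoly (F := F) r (X ∘ Equiv.swap i j)
    rw [powDet_swap _ _ _ hi hj hij, moore, powDet_swap _ _ _ hi hj hij,
      powDet_eq_moore_mul_dicksonPoly, neg_mul, neg_inj, aeval_X_left_apply] at h
    exact (mul_left_cancel₀ (moore_X_ne_zero _) h).symm
  conv_rhs => rw [← h1, aeval_aeval_apply]
  simp [Function.comp_def]

theorem dicksonPoly_update (r : ℕ) {i : ℕ} (hi : i < r + 1) (c : ℕ → F) (hc : c i ≠ 0)
    (v : ℕ → MvPolynomial ℕ F) :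
    aeval (update v i (lin (r + 1) c v)) (dicksonPoly F (r + 1))
      = aeval v (dicksonPoly F (r + 1)) := by
  have h1 : aeval (update (X : ℕ → MvPolynomial ℕ F) i (lin (r + 1) c X)) (dicksonPoly F (r + 1))
      = dicksonPoly F (r + 1) := by
    have h := powDet_eq_moore_mul_dicksonPoly (F := F) r (update X i (lin (r + 1) c X))
    rw [powDet_update_lin _ _ _ _ hi, moore, powDet_update_lin _ _ _ _ hi,
      powDet_eq_moore_mul_dicksonPoly, smul_mul_assoc, aeval_X_left_apply] at h
    exact (mul_left_cancel₀ (moore_X_ne_zero _) (smul_right_injective _ hc h)).symm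
  conv_rhs => rw [← h1, aeval_aeval_apply, aeval_update, aeval_lin]
  simp only [aeval_X]

theorem Good.dicksonPoly_pow_mul {m r : ℕ} {f : MvPolynomial ℕ F} (h : Good m (r + 1) f) (j : ℕ) :
    Good m (r + 1) (dicksonPoly F (r + 1) ^ j * f) :=
  h.mul_of_invariant (fun i k hi hk v => by rw [map_pow, map_pow, dicksonPoly_swap r hi hk])
    fun v c i hi hc => by rw [map_pow, map_pow, dicksonPoly_update r hi c hc]

/-- `YFrom F m (r + 1) k I J` as a polynomial. -/
def YPoly (F : Type*) [Field F] [Fintype F] (m : ℕ) :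
    (r k : ℕ) → (Fin k → ℕ) → (Fin k → ℕ) → MvPolynomial ℕ F
  | _, 0, _, _ => 1
  | r, k + 1, I, J => (deltaPoly (r + 1) m)^[I 0]
      (dicksonPoly F (r + 1) ^ J 0 * YPoly F m (r + 1) k (Fin.tail I) (Fin.tail J))

/-- The inner factor is good for r + 1, as is its product with powers of D_{r+1}; `Good.mono` lowers
this to r, which is what δ_{r+1;m} requires. -/
theorem good_YPoly (m r k : ℕ) (I J : Fin k → ℕ) :
    Good m r (YPoly F m r k I J) ∧
      YFrom F m (r + 1) k I J = algebraMap _ _ (YPoly F m r k I J) := by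
  induction k generalizing r with
  | zero => exact ⟨good_one m r, (map_one _).symm⟩
  | succ k ih =>
    obtain ⟨h1, h2⟩ := ih (r + 1) (Fin.tail I) (Fin.tail J)
    obtain ⟨h3, h4⟩ := (h1.dicksonPoly_pow_mul (J 0)).mono.iterate_deltaPoly (I 0)
    refine ⟨h3, ?_⟩
    rw [YFrom, YPoly, h2, ← algebraMap_dicksonPoly, ← map_pow, ← map_mul, h4]

theorem dropVar_dicksonPoly (r : ℕ) :
    dropVar (dicksonPoly F (r + 2)) = dicksonPoly F (r + 1) ^ q :=
  dropVar_quotient (h := 1) (by simp) (dicksonPoly_spec (r + 1)) (dicksonPoly_spec r)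

theorem dropVar_iterate_deltaPoly {m r : ℕ} {f h : MvPolynomial ℕ F} (hf : Good (m + 1) (r + 1) f)
    (hh : Good m r h) (e : dropVar f = h ^ q) (i : ℕ) :
    dropVar ((deltaPoly (r + 2) (m + 1))^[i] f) = ((deltaPoly (r + 1) m)^[i] h) ^ q := by
  induction i with
  | zero => exact e
  | succ i ih =>
    rw [iterate_succ_apply', iterate_succ_apply']
    exact dropVar_quotient ih (hf.iterate_deltaPoly i).1.numer_eq (hh.iterate_deltaPoly i).1.numer_eq

theorem dropVar_YPoly (m r k : ℕ) (I J : Fin k → ℕ) (hI : ∀ i, 0 < I i → 0 < m) :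
    dropVar (YPoly F m (r + 1) k I J) = YPoly F (m - 1) r k I J ^ q := by
  induction k generalizing r with
  | zero => simp [YPoly]
  | succ k ih =>
    have h1 := ih (r + 1) (Fin.tail I) (Fin.tail J) fun i => hI i.succ
    have h2 : dropVar (dicksonPoly F (r + 2) ^ J 0 * YPoly F m (r + 2) k (Fin.tail I) (Fin.tail J))
        = (dicksonPoly F (r + 1) ^ J 0
          * YPoly F (m - 1) (r + 1) k (Fin.tail I) (Fin.tail J)) ^ q := by
      rw [map_mul, map_pow, dropVar_dicksonPoly, h1, mul_pow, pow_right_comm]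
    rw [YPoly, YPoly]
    -- For m = 0 no operator δ is applied at this level, so the truncated m - 1 is harmless.
    rcases m with _ | m
    · have h0 : I 0 = 0 := by
        by_contra h
        exact absurd (hI 0 (Nat.pos_of_ne_zero h)) (lt_irrefl _)
      rw [h0]
      exact h2
    · exact dropVar_iterate_deltaPoly
        ((good_YPoly (m + 1) (r + 2) k _ _).1.dicksonPoly_pow_mul (J 0)).mono
        ((good_YPoly m (r + 1) k _ _).1.dicksonPoly_pow_mul (J 0)).mono h2 _

theorem deltaPoly_one (m : ℕ) (f : MvPolynomial ℕ F) (hf : Good m 0 f) :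
    deltaPoly 1 m f = X 0 ^ (q ^ m - 1) * rename Nat.succ f := by
  have h := hf.numer_eq
  have h1 : numer 1 m f (X : ℕ → MvPolynomial ℕ F) = X 0 ^ q ^ m * rename Nat.succ f := by
    simp [numer, lastRowDet, rename_eq_aeval, skip, Function.comp_def]
  have h2 : 0 < q ^ m := pow_pos Fintype.card_pos _
  rw [zero_add, h1, moore_one, ← Nat.sub_add_cancel h2, pow_succ', mul_assoc] at h
  exact (mul_left_cancel₀ (X_ne_zero 0) h).symm

theorem good_zero (m : ℕ) (f : MvPolynomial ℕ F) : Good m 0 f where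
  symm i j hi := absurd hi (Nat.not_lt_zero i)
  exch v c := by simp [lin, Fintype.card_ne_zero]

theorem dicksonPoly_one : dicksonPoly F 1 = X 0 ^ (q - 1) := by
  rw [dicksonPoly, deltaPoly_one _ _ (good_zero _ _)]
  simp

end

/-! ### Homogeneity, variables that occur, and lowest monomials -/

section

variable {F : Type*} [Field F]

/-- Multiplication by L carries the component of g in degree i to the component of L * g in degree d
+ i, and L is cancellable. -/
theorem isHomogeneous_of_mul {d n : ℕ} {L g : MvPolynomial ℕ F} (hL : L.IsHomogeneous d)
    (hL0 : L ≠ 0) (h : (L * g).IsHomogeneous n) : g.IsHomogeneous (n - d) := by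
  have h1 : ∀ i, L * homogeneousComponent i g = homogeneousComponent (d + i) (L * g) := by
    intro i
    conv_rhs => rw [← sum_homogeneousComponent g, Finset.mul_sum, map_sum]
    have h2 : ∀ j, homogeneousComponent (d + i) (L * homogeneousComponent j g)
        = if j = i then L * homogeneousComponent j g else 0 := by
      intro j
      have h3 := hL.mul (homogeneousComponent_isHomogeneous j g)
      rw [homogeneousComponent_of_mem ((mem_homogeneousSubmodule _ _).mpr h3)]
      simp only [Nat.add_left_cancel_iff, eq_comm]
    simp only [h2, Finset.sum_ite_eq', Finset.mem_range]
    split_ifs with hi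
    · rfl
    · rw [homogeneousComponent_eq_zero _ _ (by omega), mul_zero]
  intro e he
  have hw : e.degree = Finsupp.weight (1 : ℕ → ℕ) e := by
    rw [Finsupp.degree_eq_weight_one]
    rfl
  change Finsupp.weight 1 e = n - d
  rw [← hw]
  by_contra hne
  have h2 : homogeneousComponent e.degree g = 0 := by
    have h3 := h1 e.degree
    rw [homogeneousComponent_of_mem ((mem_homogeneousSubmodule _ _).mpr h),
      if_neg (by omega)] at h3
    exact (mul_eq_zero.mp h3).resolve_left hL0
  apply he
  have h4 := coeff_homogeneousComponent e.degree g e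
  rw [h2] at h4
  simpa using h4.symm

theorem mem_supported_of_mul {s : Set ℕ} {L g : MvPolynomial ℕ F} (hL0 : L ≠ 0)
    (h : L * g ∈ supported F s) : g ∈ supported F s := by
  rcases eq_or_ne g 0 with rfl | hg
  · exact zero_mem _
  rw [mem_supported] at h ⊢
  intro i hi
  apply h
  rw [Finset.mem_coe, mem_vars_iff_degreeOf_ne_zero] at hi ⊢
  rw [degreeOf_mul_eq hL0 hg]
  omega

theorem det_mem_supported {s : Set ℕ} {n : ℕ} {A : Matrix (Fin n) (Fin n) (MvPolynomial ℕ F)}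
    (h : ∀ i j, A i j ∈ supported F s) : A.det ∈ supported F s := by
  rw [Matrix.det_apply]
  refine sum_mem fun σ _ => ?_
  rw [Units.smul_def]
  exact zsmul_mem (prod_mem fun i _ => h _ _) _

/-- Homogeneous polynomials in the first `n` variables. -/
def IsForm (n : ℕ) (f : MvPolynomial ℕ F) : Prop :=
  (∃ d, f.IsHomogeneous d) ∧ f ∈ supported F (Set.Iio n)

theorem IsForm.one (n : ℕ) : IsForm n (1 : MvPolynomial ℕ F) :=
  ⟨⟨0, isHomogeneous_one _ _⟩, one_mem _⟩

theorem IsForm.mono {n k : ℕ} (hnk : n ≤ k) {f : MvPolynomial ℕ F} (h : IsForm n f) : IsForm k f :=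
  ⟨h.1, supported_mono (Set.Iio_subset_Iio hnk) h.2⟩

theorem IsForm.mul {n : ℕ} {f g : MvPolynomial ℕ F} (hf : IsForm n f) (hg : IsForm n g) :
    IsForm n (f * g) := by
  obtain ⟨⟨d, hd⟩, hf⟩ := hf
  obtain ⟨⟨e, he⟩, hg⟩ := hg
  exact ⟨⟨_, hd.mul he⟩, mul_mem hf hg⟩

theorem IsForm.pow {n : ℕ} {f : MvPolynomial ℕ F} (hf : IsForm n f) (k : ℕ) : IsForm n (f ^ k) := by
  obtain ⟨⟨d, hd⟩, hf⟩ := hf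
  exact ⟨⟨_, hd.pow k⟩, pow_mem hf k⟩

variable [Fintype F]

local notation "q" => Fintype.card F

theorem IsForm.quotient {a b n : ℕ} (han : a ≤ n + 1) {f g : MvPolynomial ℕ F} (hf : IsForm n f)
    (h : numer a b f X = moore a X * g) : IsForm (n + 1) g := by
  obtain ⟨⟨d, hd⟩, hf⟩ := hf
  have hX : ∀ j : Fin a, X (j : ℕ) ∈ supported F (Set.Iio (n + 1)) := fun j =>
    X_mem_supported.mpr (lt_of_lt_of_le j.isLt han)
  have h1 : ∀ j : ℕ, rename (skip j) f ∈ supported F (Set.Iio (n + 1)) := by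
    intro j
    rw [mem_supported] at hf ⊢
    intro i hi
    obtain ⟨k, hk, rfl⟩ := Finset.mem_image.mp (vars_rename _ _ hi)
    have : k < n := hf hk
    simp only [skip, Set.mem_Iio]
    split_ifs <;> omega
  have h2 : numer a b f X ∈ supported F (Set.Iio (n + 1)) := by
    refine det_mem_supported fun i j => ?_
    simp only [Matrix.of_apply]
    split_ifs
    · rw [← rename_eq_aeval]
      exact mul_mem (pow_mem (hX j) _) (h1 _)
    · exact pow_mem (hX j) _
  have h3 : (numer a b f X).IsHomogeneous
      (∑ i : Fin a, if (i : ℕ) + 1 = a then q ^ b + d else q ^ (i : ℕ)) := by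
    refine isHomogeneous_det (fun i j => ?_) rfl
    simp only [Matrix.of_apply]
    split_ifs
    · rw [← rename_eq_aeval]
      exact (isHomogeneous_X_pow _ _).mul hd.rename_isHomogeneous
    · exact isHomogeneous_X_pow _ _
  rw [h] at h2 h3
  exact ⟨⟨_, isHomogeneous_of_mul (moore_isHomogeneous a) (moore_X_ne_zero a) h3⟩,
    mem_supported_of_mul (moore_X_ne_zero a) h2⟩

theorem isForm_dicksonPoly (r : ℕ) : IsForm (r + 1) (dicksonPoly F (r + 1)) :=
  (IsForm.one r).quotient le_rfl (dicksonPoly_spec r)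

theorem IsForm.iterate_deltaPoly {m r n : ℕ} (hrn : r ≤ n) {f : MvPolynomial ℕ F} (hf : Good m r f)
    (hn : IsForm n f) (i : ℕ) : IsForm (n + i) ((deltaPoly (r + 1) m)^[i] f) := by
  induction i with
  | zero => exact hn
  | succ i ih =>
    rw [iterate_succ_apply']
    exact ih.quotient (by omega) (hf.iterate_deltaPoly i).1.numer_eq

theorem isForm_YPoly (m r k : ℕ) (I J : Fin k → ℕ) :
    IsForm (r + (k + ∑ i, I i)) (YPoly F m r k I J) := by
  induction k generalizing r with
  | zero => exact IsForm.one _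
  | succ k ih =>
    have h1 := ((isForm_dicksonPoly (F := F) r).mono (k := r + 1 + (k + ∑ i, Fin.tail I i))
      (by omega)).pow (J 0) |>.mul (ih (r + 1) (Fin.tail I) (Fin.tail J))
    have h2 := h1.iterate_deltaPoly (r := r) (m := m) (by omega)
      ((good_YPoly m (r + 1) k _ _).1.dicksonPoly_pow_mul (J 0)).mono (I 0)
    rw [YPoly]
    convert h2 using 1
    rw [Fin.sum_univ_succ]
    simp only [Fin.tail]
    omega

omit [Fintype F] in
/-- `e` is the smallest exponent of `P` in the lexicographic order. -/
def IsLow (e : ℕ →₀ ℕ) (P : MvPolynomial ℕ F) : Prop :=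
  e ∈ P.support ∧ ∀ d ∈ P.support, d = e ∨ ∃ i, (∀ j < i, d j = e j) ∧ e i < d i

/-- The exponent vector of the monomial with its variables shifted by one. -/
def shift (e : ℕ →₀ ℕ) : ℕ →₀ ℕ := e.mapDomain Nat.succ

theorem shift_zero (e : ℕ →₀ ℕ) : shift e 0 = 0 :=
  Finsupp.mapDomain_of_notMem_range _ _ (by simp)

theorem shift_succ (e : ℕ →₀ ℕ) (i : ℕ) : shift e (i + 1) = e i :=
  Finsupp.mapDomain_apply Nat.succ_injective _ _

theorem exists_shift_eq {d : ℕ →₀ ℕ} (h : d 0 = 0) : ∃ e, d = shift e := by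
  refine ⟨d.comapDomain Nat.succ Nat.succ_injective.injOn, ?_⟩
  ext i
  rcases i with _ | i
  · rw [h, shift_zero]
  · rw [shift_succ]
    rfl

theorem lexLt_shift {d e : ℕ →₀ ℕ} (h : d = e ∨ ∃ i, (∀ j < i, d j = e j) ∧ e i < d i) :
    shift d = shift e ∨ ∃ i, (∀ j < i, shift d j = shift e j) ∧ shift e i < shift d i := by
  rcases h with rfl | ⟨i, h1, h2⟩
  · exact Or.inl rfl
  · refine Or.inr ⟨i + 1, ?_, by rwa [shift_succ, shift_succ]⟩
    rintro (_ | j) hj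
    · rw [shift_zero, shift_zero]
    · rw [shift_succ, shift_succ, h1 j (by omega)]

namespace IsLow

omit [Fintype F]

variable {e : ℕ →₀ ℕ} {P : MvPolynomial ℕ F}

theorem one : IsLow 0 (1 : MvPolynomial ℕ F) := by
  constructor
  · simp
  · intro d hd
    left
    by_contra h
    rw [mem_support_iff, coeff_one, if_neg (Ne.symm h)] at hd
    exact hd rfl

theorem rename_succ (h : IsLow e P) : IsLow (shift e) (rename Nat.succ P) := by
  classical
  have h1 := support_rename_of_injective (p := P) Nat.succ_injective
  constructor
  · rw [h1]
    exact Finset.mem_image_of_mem _ h.1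
  · intro d hd
    rw [h1] at hd
    obtain ⟨d, hd', rfl⟩ := Finset.mem_image.mp hd
    exact lexLt_shift (h.2 d hd')

theorem X_pow_mul (h : IsLow e P) (i n : ℕ) :
    IsLow (e + Finsupp.single i n) (X i ^ n * P) := by
  induction n with
  | zero => simpa using h
  | succ n ih =>
    rw [pow_succ', mul_assoc, Finsupp.single_add, ← add_assoc, add_comm _ (Finsupp.single i 1)]
    constructor
    · rw [support_X_mul]
      exact Finset.mem_map_of_mem (addLeftEmbedding _) ih.1
    · intro d hd
      rw [support_X_mul] at hd
      obtain ⟨d, hd', rfl⟩ := Finset.mem_map.mp hd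
      rcases ih.2 d hd' with rfl | ⟨k, h1, h2⟩
      · exact Or.inl rfl
      · refine Or.inr ⟨k, fun j hj => ?_, ?_⟩
        · simp only [addLeftEmbedding_apply, Finsupp.add_apply] at h1 ⊢
          rw [h1 j hj]
        · simp only [addLeftEmbedding_apply, Finsupp.add_apply] at h2 ⊢
          omega

theorem expand {p : ℕ} (hp : 0 < p) (h : IsLow e P) : IsLow (p • e) (MvPolynomial.expand p P) := by
  classical
  have h1 := support_expand P hp.ne'
  constructor
  · rw [h1]
    exact Finset.mem_image_of_mem _ h.1
  · intro d hd
    rw [h1] at hd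
    obtain ⟨d, hd', rfl⟩ := Finset.mem_image.mp hd
    rcases h.2 d hd' with rfl | ⟨k, h1, h2⟩
    · exact Or.inl rfl
    · refine Or.inr ⟨k, fun j hj => ?_, ?_⟩
      · simp [h1 j hj]
      · simpa [hp] using h2

/-- `dropVar P` records exactly the terms of P free of x_1, and these precede all terms that contain
x_1. -/
theorem of_dropVar (h : IsLow e (dropVar P)) : IsLow (shift e) P := by
  classical
  have h1 : X 0 ∣ P - rename Nat.succ (dropVar P) := by
    have := (sub_dvd_iff (s := 0) (p := (0 : MvPolynomial ℕ F)) (map_zero _)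
      (P - rename Nat.succ (dropVar P))).mpr ?_
    · simpa using this
    · rw [map_sub, sub_eq_zero, dropVar, rename_eq_aeval, aeval_aeval_apply, aeval_aeval_apply]
      congr 2
      ext1 i
      rcases i with _ | i <;> simp
  obtain ⟨W, hW⟩ := h1
  have h2 : ∀ d, coeff (shift d) P = coeff d (dropVar P) := by
    intro d
    conv_lhs => rw [sub_eq_iff_eq_add.mp hW]
    rw [coeff_add, coeff_X_mul', if_neg (by simp [shift_zero]), zero_add]
    exact coeff_rename_mapDomain Nat.succ Nat.succ_injective (dropVar P) d
  constructor
  · rw [mem_support_iff, h2]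
    exact mem_support_iff.mp h.1
  · intro d hd
    rcases Nat.eq_zero_or_pos (d 0) with h0 | h0
    · obtain ⟨d, rfl⟩ := exists_shift_eq h0
      rw [mem_support_iff, h2, ← mem_support_iff] at hd
      exact lexLt_shift (h.2 d hd)
    · exact Or.inr ⟨0, by simp, by rwa [shift_zero]⟩

end IsLow

/-- Coefficients in F_q are fixed by Frobenius. Thus a q-th power multiplies exponents by q, which
is how `IsLow` passes through it. -/
theorem expand_card_eq_pow (P : MvPolynomial ℕ F) : MvPolynomial.expand q P = P ^ q := by
  have : (MvPolynomial.expand q : MvPolynomial ℕ F →ₐ[F] _) = FiniteField.frobeniusAlgHom F (MvPolynomial ℕ F) :=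
    algHom_ext fun i => by simp
  rw [this, FiniteField.coe_frobeniusAlgHom]

/-- The lowest exponent of `YPoly F m 0 k I J`. -/
def lowExp (p : ℕ) : (m k : ℕ) → (Fin k → ℕ) → (Fin k → ℕ) → (ℕ →₀ ℕ)
  | _, 0, _, _ => 0
  | m, k + 1, I, J => (fun e => shift e + Finsupp.single 0 (p ^ m - 1))^[I 0]
      (shift (p • lowExp p (m - 1) k (Fin.tail I) (Fin.tail J))
        + Finsupp.single 0 (J 0 * (p - 1)))

theorem isLow_YPoly (m k : ℕ) (I J : Fin k → ℕ) (hI : ∀ s : Fin k, 0 < I s → (s : ℕ) ≤ m) :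
    IsLow (lowExp q m k I J) (YPoly F m 0 k I J) := by
  induction k generalizing m with
  | zero => exact IsLow.one
  | succ k ih =>
    have hI' : ∀ s : Fin k, 0 < I s.succ → (s : ℕ) + 1 ≤ m := fun s hs => by
      simpa using hI s.succ hs
    have h1 := ih (m - 1) (Fin.tail I) (Fin.tail J) fun s hs => by
      have := hI' s hs
      omega
    have h2 : IsLow (shift (q • lowExp q (m - 1) k (Fin.tail I) (Fin.tail J)))
        (YPoly F m 1 k (Fin.tail I) (Fin.tail J)) := by
      refine IsLow.of_dropVar ?_
      rw [dropVar_YPoly m 0 k _ _ fun s hs => by have := hI' s hs; omega, ← expand_card_eq_pow]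
      exact h1.expand Fintype.card_pos
    have h3 := h2.X_pow_mul 0 (J 0 * (q - 1))
    rw [YPoly, zero_add, dicksonPoly_one, ← pow_mul, mul_comm (q - 1), lowExp]
    induction I 0 with
    | zero => exact h3
    | succ i ih' =>
      rw [iterate_succ_apply', iterate_succ_apply', deltaPoly_one _ _ (good_zero _ _)]
      exact ih'.rename_succ.X_pow_mul 0 _

end

/-! ### Closed form of the lowest exponent -/

section

theorem iterate_shift_add_single (a i : ℕ) (e : ℕ →₀ ℕ) :
    (fun e => shift e + Finsupp.single 0 a)^[i] e
      = e.mapDomain (· + i) + ∑ t : Fin i, Finsupp.single (t : ℕ) a := by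
  induction i with
  | zero => exact (add_zero _).symm.trans (congrArg₂ _ Finsupp.mapDomain_id.symm (by simp))
  | succ i ih =>
    rw [iterate_succ_apply', ih, Fin.sum_univ_succ]
    simp only [shift, Finsupp.mapDomain_add, Finsupp.mapDomain_finsetSum,
      Finsupp.mapDomain_single, ← Finsupp.mapDomain_comp]
    rw [add_assoc, add_comm (∑ _, _)]
    rfl

theorem sum_Iio_succ {k : ℕ} (I : Fin (k + 1) → ℕ) (s : Fin k) :
    ∑ r ∈ Finset.Iio s.succ, I r = I 0 + ∑ r ∈ Finset.Iio s, Fin.tail I r := by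
  have h : ∀ {n : ℕ} (f : Fin n → ℕ) (s : Fin n),
      ∑ r ∈ Finset.Iio s, f r = ∑ r, if r < s then f r else 0 := by
    intro n f s
    rw [← Finset.sum_filter]
    congr 1
    ext
    simp
  rw [h, h, Fin.sum_univ_succ]
  simp [Fin.tail]

/-- The exponent vector `lowExponent`, with the variables indexed by `ℕ`. -/
theorem mapDomain_lowExponent (p m k : ℕ) (I J : Fin k → ℕ)
    (hI : ∀ s : Fin k, 0 < I s → (s : ℕ) ≤ m) :
    (lowExponent p m I J).mapDomain (fun i : Fin (k + ∑ r, I r) => (i : ℕ)) = lowExp p m k I J := by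
  have hgen : ∀ {k : ℕ} (m : ℕ) (I J : Fin k → ℕ),
      (lowExponent p m I J).mapDomain (fun i : Fin (k + ∑ r, I r) => (i : ℕ)) = ∑ s : Fin k,
        ((∑ t : Fin (I s), Finsupp.single ((∑ r ∈ Finset.Iio s, I r) + (s : ℕ) + (t : ℕ))
            (p ^ m - p ^ (s : ℕ)))
          + Finsupp.single ((∑ r ∈ Finset.Iio s, I r) + (s : ℕ) + I s)
            (J s * p ^ (s : ℕ) * (p - 1))) := by
    intro k m I J
    simp only [lowExponent, Finsupp.mapDomain_add, Finsupp.mapDomain_finsetSum,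
      Finsupp.mapDomain_single]
    rfl
  induction k generalizing m with
  | zero => simp [hgen, lowExp]
  | succ k ih =>
    have h1 := ih (m - 1) (Fin.tail I) (Fin.tail J) fun s hs => by
      have := hI s.succ hs
      rw [Fin.val_succ] at this
      omega
    rw [lowExp, ← h1, iterate_shift_add_single, hgen, hgen, Fin.sum_univ_succ, add_comm]
    have h2 : Finset.Iio (0 : Fin (k + 1)) = ∅ := by
      ext
      simp
    simp only [shift, Finsupp.mapDomain_add, Finsupp.mapDomain_single, ← Finsupp.mapDomain_comp,
      h2, Finset.sum_empty, Fin.val_zero, pow_zero, mul_one, zero_add]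
    rw [add_assoc, add_comm (Finsupp.single (I 0) _)]
    congr 1
    rw [Finset.smul_sum, Finsupp.mapDomain_finsetSum]
    refine Finset.sum_congr rfl fun s _ => ?_
    rw [smul_add, Finsupp.mapDomain_add, Finset.smul_sum, Finsupp.mapDomain_finsetSum]
    simp only [Finsupp.smul_single, Finsupp.mapDomain_single, sum_Iio_succ, comp_apply,
      smul_eq_mul, Fin.val_succ]
    congr 1
    · refine Finset.sum_congr rfl fun t _ => ?_
      -- A nonempty block forces m ≥ 1, so that p (p^{m-1} - p^s) = p^m - p^{s+1}; this fails for
      -- the truncated m - 1 at m = 0.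
      have hm : (s : ℕ) + 1 ≤ m := hI s.succ (lt_of_le_of_lt (Nat.zero_le _) t.isLt)
      obtain ⟨n, rfl⟩ : ∃ n, m = n + 1 := ⟨m - 1, by omega⟩
      congr 1
      · omega
      · rw [Nat.add_sub_cancel, Nat.mul_sub, pow_succ', pow_succ']
    · congr 1
      · simp only [Fin.tail]
        omega
      · simp only [Fin.tail]
        ring

end

end BorelInv

end

/-! ### Descent to finitely many variables and the graded lexicographic order -/

theorem corollary5p4 {F : Type*} [Field F] [Fintype F] (m k : ℕ) (I J : Fin k → ℕ)
    (hI : ∀ s : Fin k, 0 < I s → (s : ℕ) ≤ m) :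
    ∃ P : MvPolynomial (Fin (k + ∑ r, I r)) F,
      BorelInv.polyToRat (k + ∑ r, I r) P = BorelInv.Y F m I J ∧
      BorelInv.lowExponent (Fintype.card F) m I J ∈ P.support ∧
      ∀ d ∈ P.support,
        BorelInv.lowExponent (Fintype.card F) m I J ≼[MonomialOrder.degLex] d := by
  classical
  have hinj : Function.Injective (fun i : Fin (k + ∑ r, I r) => (i : ℕ)) := Fin.val_injective
  obtain ⟨⟨D, hD⟩, hv⟩ := BorelInv.isForm_YPoly (F := F) m 0 k I J
  obtain ⟨P, hP⟩ := exists_rename_eq_of_vars_subset_range (BorelInv.YPoly F m 0 k I J)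
    (fun i : Fin (k + ∑ r, I r) => (i : ℕ)) hinj (by
      rw [mem_supported, zero_add] at hv
      exact fun i hi => ⟨⟨i, hv hi⟩, rfl⟩)
  have hlow := BorelInv.isLow_YPoly (F := F) m k I J hI
  rw [← BorelInv.mapDomain_lowExponent _ _ _ _ _ hI, ← hP] at hlow
  rw [← hP, IsHomogeneous.rename_isHomogeneous_iff hinj] at hD
  have hmem : ∀ d, d.mapDomain (fun i : Fin (k + ∑ r, I r) => (i : ℕ)) ∈
      (rename (fun i : Fin (k + ∑ r, I r) => (i : ℕ)) P).support ↔ d ∈ P.support := by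
    intro d
    rw [mem_support_iff, mem_support_iff, coeff_rename_mapDomain _ hinj]
  have hE := (hmem _).mp hlow.1
  refine ⟨P, ?_, hE, fun d hd => ?_⟩
  · rw [BorelInv.polyToRat, hP, BorelInv.Y, (BorelInv.good_YPoly m 0 k I J).2]
  · rw [MonomialOrder.degLex_le_iff, Finsupp.DegLex.le_iff]
    -- By homogeneity all degrees agree, so only the lexicographic tie-break remains.
    have hdeg : ∀ d ∈ P.support, d.degree = D := fun d hd => by
      rw [Finsupp.degree_eq_weight_one]
      exact hD (mem_support_iff.mp hd)
    refine Or.inr ⟨(hdeg _ hE).trans (hdeg _ hd).symm, ?_⟩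
    rcases hlow.2 _ ((hmem d).mpr hd) with h | ⟨i, h1, h2⟩
    · rw [Finsupp.mapDomain_injective hinj h]
    · by_cases hi : i < k + ∑ r, I r
      · refine le_of_lt (Finsupp.Lex.lt_iff.mpr ⟨⟨i, hi⟩, fun j hj => ?_, ?_⟩)
        · have := h1 j hj
          rw [Finsupp.mapDomain_apply hinj, Finsupp.mapDomain_apply hinj] at this
          exact this.symm
        · have h3 := Finsupp.mapDomain_apply hinj d ⟨i, hi⟩
          have h4 := Finsupp.mapDomain_apply hinj
            (BorelInv.lowExponent (Fintype.card F) m I J) ⟨i, hi⟩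
          simp only at h3 h4
          rw [h3, h4] at h2
          exact h2
      -- A first difference at an index outside the n variables is impossible, since the exponent of
      -- d there is 0.
      · rw [Finsupp.mapDomain_of_notMem_range d i (by rintro ⟨j, rfl⟩; exact hi j.isLt)] at h2
        exact absurd h2 (Nat.not_lt_zero _)
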